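/- Conventions. A blackboard framed link (BFL) is an unoriented link diagram in the plane, up to plane isotopy (the framing of a component is its writhe, so the diagram is all the data; the empty diagram is allowed). More generally, for $k,l\ge 0$ a $(k,l)$-diagram is such a diagram in a horizontal strip with $k$ end points on the bottom line and $l$ end points on the top line, up to plane isotopy of the strip that fixes the end points; BFLs are the $(0,0)$-diagrams. Diagrams are presented combinatorially, as finite stacks of elementary slices, each consisting of vertical strands and exactly one local minimum, local maximum or crossing. Plane isotopy is then the equivalence relation generated by exchanging the heights of neighbouring events that are horizontally disjoint, cancelling a minimum against a maximum along a strand (on either side), and rotating a crossing past a maximum or a minimum. A move is a family of pairs of diagram pieces with the same end points. Applying it to a diagram means that a piece in a disc (rectangle) is replaced by the other piece of the pair, in either direction, the rest of the diagram being unchanged. A curl on an upward strand has a writhe $\varepsilon=\pm1$ and lies on a side, left (rotation $+1$) or right (rotation $-1$). An $n$-cable is a bundle of $n$ parallel strands; a curl of sign $\varepsilon$ on an $n$-cable has $n^2$ crossings, and each strand of it has a curl of writhe $\varepsilon$ on that side. The moves are, for all signs $\varepsilon$ and both sides: * $K_0$: create or delete a disjoint one-crossing figure-eight knot diagram $\infty$,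 of either crossing type. * $K_1$ (ribbon move): replace a curl of writhe $\varepsilon$ on one side of a strand by the curl of the same writhe $\varepsilon$ on the other side. * $K_2$, $K_3$: the Reidemeister moves II and III. * $K_4(n)$, $n\ge1$: replace an $n$-cable making a curl of sign $\varepsilon$ by a straight $n$-cable that passes through one lobe of an $\infty$-shaped component of writhe $-\varepsilon$ (one of the two arcs of this lobe passes over all $n$ strands, the other one under all of them). * $K_5(n)$, $n\ge1$: replace an $n$-cable making two successive curls of opposite signs $\varepsilon,-\varepsilon$ on the same side by the straight $n$-cable. Let $\mathcal K^0=\{K_0,K_2,K_3\}\cup\{K_4(n),K_5(n):n\ge1\}$ (Kauffman's calculus) and $\mathcal K^1=\{K_0,K_1,K_2,K_3\}\cup\{K_4(n):n\ge1\}$. Theorem. (1) For every $n\ge1$ and all $k,l\ge0$: if two $(k,l)$-diagrams differ by one application of $K_5(n)$, then one can be transformed into the other by plane isotopy and finitely many moves $K_1,K_2,K_3$. In particular, this holds for BFLs. (2) $\mathcal K^0$ and $\mathcal K^1$ are equivalent: two BFLs are connected by plane isotopy and a finite sequence of moves of $\mathcal K^0$ if and only if they are connected by plane isotopy and a finite sequence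 of moves of $\mathcal K^1$. -/

import Mathlib

/-! Unoriented link diagrams in the plane, described by generic height slices.

A diagram is read from bottom to top as a list of elementary slices; in every slice all strands
run vertically except for one local event: a minimum, a maximum or a crossing.  Strands are
numbered from the left, starting with `0`. -/

/-- The elementary events of a diagram.  In `cross true` the over-strand runs from bottom left to
top right, in `cross false` it runs from bottom right to top left. -/
inductive Event : Type
  | cup : Event
  | cap : Event
  | cross (b : Bool) : Event
  deriving DecidableEq

namespace Event

/-- Number of strand ends at the bottom of an event. -/
def bot : Event → ℕ
  | cup => 0
  | cap => 2
  | cross _ => 2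

/-- Number of strand ends at the top of an event. -/
def top : Event → ℕ
  | cup => 2
  | cap => 0
  | cross _ => 2

end Event

/-- An elementary slice: an event with exactly `pos` vertical strands to its left. -/
structure Slice where
  event : Event
  pos : ℕ
  deriving DecidableEq

namespace Slice

/-- A local minimum with `i` strands to its left. -/
def cup (i : ℕ) : Slice := ⟨Event.cup, i⟩

/-- A local maximum with `i` strands to its left. -/
def cap (i : ℕ) : Slice := ⟨Event.cap, i⟩

/-- A crossing with `i` strands to its left. -/
def cross (b : Bool) (i : ℕ) : Slice := ⟨Event.cross b, i⟩

end Slice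

/-- A stack of slices, listed from bottom to top. -/
abbrev Stack : Type := List Slice

/-- The stack fits together, starting with `m` strands at the bottom and ending with `n` strands
at the top. -/
def IsDiagram : ℕ → Stack → ℕ → Prop
  | m, [], n => m = n
  | m, s :: d, n => s.pos + s.event.bot ≤ m ∧ IsDiagram (m - s.event.bot + s.event.top) d n

/-- Diagrams in a horizontal strip with `m` end points at the bottom and `n` at the top. -/
def Diagram (m n : ℕ) : Type := {d : Stack // IsDiagram m d n}

/-- Blackboard framed links: link diagrams in the plane, without end points.  The framing of a
component is its writhe, so that the diagram is all the data. -/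
abbrev BFL : Type := Diagram 0 0

/-- The same stack with `i` further vertical strands on its left. -/
def shift (i : ℕ) (p : Stack) : Stack := p.map fun s => ⟨s.event, i + s.pos⟩

/-- `A` and `B` differ only inside a rectangle, in which one of them shows the piece `p` and the
other one the piece `q`, with `R p q`. -/
def Replaces (R : Stack → Stack → Prop) {m n : ℕ} (A B : Diagram m n) : Prop :=
  ∃ (u v p q : Stack) (i : ℕ), R p q ∧
    A.1 = u ++ shift i p ++ v ∧ B.1 = u ++ shift i q ++ v

/-- The elementary plane isotopies between stacks of slices: events that are next to each other
exchange their heights, a minimum and a maximum cancel along a strand, and a crossing is rotated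
past a maximum or a minimum. -/
inductive PlaneIsotopy : Stack → Stack → Prop
  | exchange (s t : Event) (g : ℕ) :
      PlaneIsotopy [⟨s, 0⟩, ⟨t, s.top + g⟩] [⟨t, s.bot + g⟩, ⟨s, 0⟩]
  | zigzag_left : PlaneIsotopy [Slice.cup 1, Slice.cap 0] []
  | zigzag_right : PlaneIsotopy [Slice.cup 0, Slice.cap 1] []
  | rotate_cap (b : Bool) :
      PlaneIsotopy [Slice.cross b 1, Slice.cap 0] [Slice.cross (!b) 0, Slice.cap 1]
  | rotate_cup (b : Bool) :
      PlaneIsotopy [Slice.cup 0, Slice.cross b 1] [Slice.cup 1, Slice.cross (!b) 0]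

/-- `n` parallel minima, nested into each other, with `i` strands to their left. -/
def cableCup (n i : ℕ) : Stack := (List.range n).map fun k => Slice.cup (i + k)

/-- `n` parallel maxima, nested into each other, with `i` strands to their left. -/
def cableCap (n i : ℕ) : Stack := (List.range n).reverse.map fun k => Slice.cap (i + k)

/-- A cable of `k` parallel strands crosses the cable of `l` parallel strands to its right,
with `i` strands to the left of both; all `k * l` crossings are of the same kind `b`, so that one
cable lies entirely above the other. -/
def cableCross (b : Bool) (k l i : ℕ) : Stack :=
  (List.range k).reverse.flatMap fun x => (List.range l).map fun y => Slice.cross b (i + x + y)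

/-- A cable of `n` parallel vertical strands making one curl.  Each strand gets writhe `+1` from
its curl if `b = true`, and `-1` if `b = false`; the loop lies to the right of the cable (it is
traversed clockwise, if the cable is oriented upwards) if `r = true`, and to its left
(traversed counterclockwise) if `r = false`. -/
def cableCurl (n : ℕ) (b r : Bool) : Stack :=
  if r then cableCup n n ++ cableCross b n n 0 ++ cableCap n n
  else cableCup n 0 ++ cableCross b n n n ++ cableCap n 0

/-- A curl on one strand. -/
def curl (b r : Bool) : Stack := cableCurl 1 b r

/-- A figure eight curve with a single crossing. Its writhe is `-1` if `b = true`, and `+1` if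
`b = false`. -/
def infinityKnot (b : Bool) : Stack := [Slice.cup 0, Slice.cross b 0, Slice.cap 0]

/-- `n` parallel vertical strands that pass through one lobe of a figure eight curve whose
self-crossing is `b`.  The lower arc of that lobe passes over all the strands and the upper arc
under all of them if `c = true`, and the other way round if `c = false`. -/
def encircled (n : ℕ) (b c : Bool) : Stack :=
  [Slice.cup 0] ++ cableCross c 1 n 1 ++ cableCross c n 1 1 ++ [Slice.cross b 0, Slice.cap 0]

/-- Names of the moves. -/
inductive Move : Type
  | K0 : Move
  | K1 : Move
  | K2 : Move
  | K3 : Move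
  | K4 (n : ℕ) : Move
  | K5 (n : ℕ) : Move

/-- The pairs of pieces that a move allows to exchange.  Every move is taken with both
signs of its curls and with the curls on either side.

* `K0`: a figure eight knot diagram with one crossing is created or deleted.
* `K1` (ribbon move): a curl is replaced by the curl of the same writhe on the other side.
* `K2`, `K3`: the second and the third Reidemeister move.
* `K4 n`: a cable of `n` strands that makes a curl is replaced by a straight cable through one
  lobe of a figure eight curve, whose writhe is opposite to that of the curl.
* `K5 n`: on a cable of `n` strands two successive curls on the same side,
  of opposite writhe, are created or deleted. -/
inductive Move.Pieces : Move → Stack → Stack → Prop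
  | K0 (b : Bool) : Move.Pieces Move.K0 (infinityKnot b) []
  | K1 (b : Bool) : Move.Pieces Move.K1 (curl b true) (curl b false)
  | K2 (b : Bool) : Move.Pieces Move.K2 [Slice.cross b 0, Slice.cross (!b) 0] []
  /-- `a`, `b`, `c` are the crossings of the strands 0 and 1, 0 and 2, 1 and 2; the condition
  says that the three strands lie at different heights. -/
  | K3 (a b c : Bool) (h : a = b ∨ b = c) :
      Move.Pieces Move.K3 [Slice.cross a 0, Slice.cross b 1, Slice.cross c 0]
        [Slice.cross c 1, Slice.cross b 0, Slice.cross a 1]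
  | K4 (n : ℕ) (b r c : Bool) (hn : 1 ≤ n) :
      Move.Pieces (Move.K4 n) (cableCurl n b r) (encircled n b c)
  | K5 (n : ℕ) (b r : Bool) (hn : 1 ≤ n) :
      Move.Pieces (Move.K5 n) (cableCurl n b r ++ cableCurl n (!b) r) []

/-- Two diagrams differ by one application, in either direction, of the move `M`. -/
def Move.Applies (M : Move) {m n : ℕ} (A B : Diagram m n) : Prop :=
  Replaces M.Pieces A B ∨ Replaces M.Pieces B A

/-- `A` can be transformed into `B` by plane isotopies and finitely many moves from the
set `S`. -/
def Connected (S : Set Move) {m n : ℕ} (A B : Diagram m n) : Prop :=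
  Relation.EqvGen (fun A B : Diagram m n =>
    Replaces PlaneIsotopy A B ∨ ∃ M ∈ S, Move.Applies M A B) A B

/-- Kauffman's calculus `K0, K2, K3, K4(n), K5(n)`. -/
def kauffmanCalculus : Set Move :=
  {Move.K0, Move.K2, Move.K3} ∪ {M | ∃ n, 1 ≤ n ∧ (M = Move.K4 n ∨ M = Move.K5 n)}

/-- The calculus `K0, K1, K2, K3, K4(n)`. -/
def ribbonCalculus : Set Move :=
  {Move.K0, Move.K1, Move.K2, Move.K3} ∪ {M | ∃ n, 1 ≤ n ∧ M = Move.K4 n}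

/-! ### Validity of stacks -/

/-! For part (2), the figure eight piece in `K4 1` does not remember the side of the curl. Two curls
of equal writhe on different sides are therefore exchanged by two applications of `K4 1`, which
gives `K1`. Conversely, part (1) supplies every `K5 n` from `K1`, `K2`, `K3`.

Part (1) is an induction on the number of strands. For one strand, `K1` moves one of the two curls
to the other side, and then the Whitney trick `curl_whitney` cancels two curls of opposite writhe on
opposite sides. For `n + 1` strands, `K2` and `K3` peel off one outer strand
(`cableCurl_succ_right`, `cableCurl_succ_left`). It crosses to the far side of the other strands
(`P`), curls there alone (`C`) and returns (`Q`), and the remaining `n`-cable then makes its own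
curl (`Y`). In the product of `P C Q Y` with its counterpart `P' C' Q' Y'` of opposite crossings,
`Y` commutes with `P' C' Q'`, because a strand lying entirely over or under a piece slides across
it. What remains is `P C Q P' C' Q' Y Y'`. Here `Q P'`, `C C'`, `P Q'` cancel in turn, and `Y Y'`
cancels by induction.

The calculation takes place in the relation `Eqv`, which carries validity along with connectedness
and is a congruence for stacking and for adding strands. -/

theorem isDiagram_append {m n : ℕ} {A B : Stack} :
    IsDiagram m (A ++ B) n ↔ ∃ k, IsDiagram m A k ∧ IsDiagram k B n := by
  induction A generalizing m with
  | nil => simp [IsDiagram]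
  | cons s A ih => simp [IsDiagram, ih, and_assoc]

theorem IsDiagram.append {m k n : ℕ} {A B : Stack} (hA : IsDiagram m A k)
    (hB : IsDiagram k B n) : IsDiagram m (A ++ B) n :=
  isDiagram_append.2 ⟨k, hA, hB⟩

theorem isDiagram_shift {m n i : ℕ} {A : Stack} :
    IsDiagram (i + m) (shift i A) (i + n) ↔ IsDiagram m A n := by
  induction A generalizing m with
  | nil => simp [IsDiagram, shift]
  | cons s A ih =>
    have h : IsDiagram (i + m - s.event.bot + s.event.top) (shift i A) (i + n) ∧
        s.pos + s.event.bot ≤ m ↔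
        IsDiagram (m - s.event.bot + s.event.top) A n ∧ s.pos + s.event.bot ≤ m := by
      -- The bound stays in the conjunction because only under it does the truncated subtraction
      -- commute with adding `i`.
      refine and_congr_left fun hs => ?_
      rw [← ih]
      congr! 1
      omega
    simp only [shift, List.map_cons, IsDiagram] at h ⊢
    rw [and_comm (a := s.pos + _ ≤ m), ← h]
    constructor
    · rintro ⟨h1, h2⟩
      exact ⟨h2, by omega⟩
    · rintro ⟨h1, h2⟩
      exact ⟨by omega, h1⟩

/-- No event of a shifted piece touches the leftmost `i` strands, so all of them reach the top. The
top width can then be written as `i + r`, as `isDiagram_shift` requires. -/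
theorem le_of_isDiagram_shift {m n i : ℕ} {A : Stack} (h : IsDiagram (i + m) (shift i A) n) :
    i ≤ n := by
  induction A generalizing m with
  | nil => simp only [shift, List.map_nil, IsDiagram] at h; omega
  | cons s A ih =>
    simp only [shift, List.map_cons, IsDiagram] at h
    refine ih (m := m - s.event.bot + s.event.top) ?_
    have e : i + (m - s.event.bot + s.event.top) = i + m - s.event.bot + s.event.top := by omega
    rw [e]
    exact h.2

theorem shift_append (i : ℕ) (A B : Stack) : shift i (A ++ B) = shift i A ++ shift i B :=
  List.map_append

theorem shift_shift (i j : ℕ) (A : Stack) : shift i (shift j A) = shift (i + j) A := by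
  simp [shift, Function.comp_def, add_assoc]

theorem shift_zero (A : Stack) : shift 0 A = A := by
  simp [shift]

/-! ### Equivalence of stacks -/

/-- The stacks `A` and `B`, starting with `w` strands, are valid at the same time, and then they
are connected by moves from `S`. -/
def Eqv (S : Set Move) (w : ℕ) (A B : Stack) : Prop :=
  ∀ n, (IsDiagram w A n ↔ IsDiagram w B n) ∧
    ∀ (hA : IsDiagram w A n) (hB : IsDiagram w B n),
      Connected S (⟨A, hA⟩ : Diagram w n) ⟨B, hB⟩

namespace Eqv

variable {S : Set Move} {w : ℕ} {A B C : Stack}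

theorem refl (A : Stack) : Eqv S w A A :=
  fun _ => ⟨Iff.rfl, fun _ _ => Relation.EqvGen.refl _⟩

theorem of_eq (h : A = B) : Eqv S w A B := h ▸ refl A

theorem symm (h : Eqv S w A B) : Eqv S w B A :=
  fun n => ⟨(h n).1.symm, fun hA hB => Relation.EqvGen.symm _ _ ((h n).2 hB hA)⟩

theorem trans (h : Eqv S w A B) (h' : Eqv S w B C) : Eqv S w A C :=
  fun n => ⟨(h n).1.trans (h' n).1, fun hA hC =>
    have hB := (h n).1.1 hA
    Relation.EqvGen.trans _ _ _ ((h n).2 hA hB) ((h' n).2 hB hC)⟩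

instance : Trans (Eqv S w) (Eqv S w) (Eqv S w) := ⟨trans⟩

theorem of_replaces {R : Stack → Stack → Prop} {p q : Stack} (i : ℕ) (hR : R p q)
    (hC : ∀ {m n : ℕ} {A B : Diagram m n}, Replaces R A B → Connected S A B)
    (h : ∀ n, IsDiagram w (shift i p) n ↔ IsDiagram w (shift i q) n) :
    Eqv S w (shift i p) (shift i q) :=
  fun n => ⟨h n, fun _ _ => hC ⟨[], [], p, q, i, hR, by simp, by simp⟩⟩

theorem of_isotopy {p q : Stack} (i : ℕ) (hR : PlaneIsotopy p q)
    (h : ∀ n, IsDiagram w (shift i p) n ↔ IsDiagram w (shift i q) n) :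
    Eqv S w (shift i p) (shift i q) :=
  of_replaces i hR (fun h => Relation.EqvGen.rel _ _ (Or.inl h)) h

theorem of_move {p q : Stack} {M : Move} (hM : M ∈ S) (i : ℕ) (hR : M.Pieces p q)
    (h : ∀ n, IsDiagram w (shift i p) n ↔ IsDiagram w (shift i q) n) :
    Eqv S w (shift i p) (shift i q) :=
  of_replaces i hR (fun h => Relation.EqvGen.rel _ _ (Or.inr ⟨M, hM, Or.inl h⟩)) h

end Eqv

theorem Replaces.congr {R : Stack → Stack → Prop} {m n m' n' i : ℕ} {A B : Diagram m n}
    {A' B' : Diagram m' n'} {u v : Stack} (h : Replaces R A B)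
    (hA : A'.1 = u ++ shift i A.1 ++ v) (hB : B'.1 = u ++ shift i B.1 ++ v) :
    Replaces R A' B' := by
  obtain ⟨x, y, p, q, j, hR, eA, eB⟩ := h
  refine ⟨u ++ shift i x, shift i y ++ v, p, q, i + j, hR, ?_, ?_⟩
  · simp [hA, eA, shift_append, shift_shift]
  · simp [hB, eB, shift_append, shift_shift]

/-- The hypothesis `hv` runs over all `D` because the intermediate diagrams of a chain of moves must
fit into the surroundings too. -/
theorem Connected.congr {S : Set Move} {m n m' n' i : ℕ} {A B : Diagram m n} {u v : Stack}
    (h : Connected S A B)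
    (hv : ∀ D : Diagram m n, IsDiagram m' (u ++ shift i D.1 ++ v) n') :
    Connected S (⟨_, hv A⟩ : Diagram m' n') ⟨_, hv B⟩ := by
  induction h with
  | rel A B h =>
    refine Relation.EqvGen.rel _ _ ?_
    rcases h with h | ⟨M, hM, h | h⟩
    · exact Or.inl (h.congr rfl rfl)
    · exact Or.inr ⟨M, hM, Or.inl (h.congr rfl rfl)⟩
    · exact Or.inr ⟨M, hM, Or.inr (h.congr rfl rfl)⟩
  | refl A => exact Relation.EqvGen.refl _
  | symm A B _ ih => exact Relation.EqvGen.symm _ _ ih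
  | trans A B C _ _ ih ih' => exact Relation.EqvGen.trans _ _ _ ih ih'

theorem IsDiagram.unique {m n n' : ℕ} {A : Stack} (h : IsDiagram m A n)
    (h' : IsDiagram m A n') : n = n' := by
  induction A generalizing m with
  | nil => exact (show m = n from h).symm.trans h'
  | cons s A ih => exact ih h.2 h'.2

namespace Eqv

variable {S : Set Move} {w : ℕ} {A B : Stack}

/-- Replacing a piece inside a stack, to the right of `i` strands. -/
theorem congr {i : ℕ} (u v : Stack)
    (h : ∀ w', IsDiagram w u w' → ∃ k, w' = i + k ∧ Eqv S k A B) :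
    Eqv S w (u ++ shift i A ++ v) (u ++ shift i B ++ v) := by
  have key : ∀ n w₁ w₂, IsDiagram w u w₁ → IsDiagram w₂ v n →
      (IsDiagram w₁ (shift i A) w₂ ↔ IsDiagram w₁ (shift i B) w₂) := by
    intro n w₁ w₂ h₁ h₂
    obtain ⟨k, rfl, e⟩ := h w₁ h₁
    constructor
    · intro a
      obtain ⟨r, rfl⟩ := Nat.exists_eq_add_of_le (le_of_isDiagram_shift a)
      exact isDiagram_shift.2 ((e r).1.1 (isDiagram_shift.1 a))
    · intro a
      obtain ⟨r, rfl⟩ := Nat.exists_eq_add_of_le (le_of_isDiagram_shift a)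
      exact isDiagram_shift.2 ((e r).1.2 (isDiagram_shift.1 a))
  intro n
  refine ⟨?_, ?_⟩
  · simp only [isDiagram_append]
    constructor
    · rintro ⟨w₂, ⟨w₁, h₁, a⟩, h₂⟩
      exact ⟨w₂, ⟨w₁, h₁, (key n w₁ w₂ h₁ h₂).1 a⟩, h₂⟩
    · rintro ⟨w₂, ⟨w₁, h₁, a⟩, h₂⟩
      exact ⟨w₂, ⟨w₁, h₁, (key n w₁ w₂ h₁ h₂).2 a⟩, h₂⟩
  · intro hA hB
    obtain ⟨w₂, hA', h₂⟩ := isDiagram_append.1 hA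
    obtain ⟨w₁, h₁, a⟩ := isDiagram_append.1 hA'
    have b := (key n w₁ w₂ h₁ h₂).1 a
    obtain ⟨k, rfl, e⟩ := h w₁ h₁
    obtain ⟨r, rfl⟩ := Nat.exists_eq_add_of_le (le_of_isDiagram_shift a)
    exact ((e r).2 (isDiagram_shift.1 a) (isDiagram_shift.1 b)).congr
      fun D => (h₁.append (isDiagram_shift.2 D.2)).append h₂

/-- Replacing a piece inside a stack. -/
theorem mid (u v : Stack) (h : ∀ w', IsDiagram w u w' → Eqv S w' A B) :
    Eqv S w (u ++ (A ++ v)) (u ++ (B ++ v)) := by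
  have := congr (i := 0) u v fun w' hw => ⟨w', (zero_add w').symm, h w' hw⟩
  simpa [shift_zero] using this

theorem append_left (u : Stack) (h : ∀ w', IsDiagram w u w' → Eqv S w' A B) :
    Eqv S w (u ++ A) (u ++ B) := by
  simpa using mid u [] h

theorem append_right (v : Stack) (h : Eqv S w A B) : Eqv S w (A ++ v) (B ++ v) := by
  refine mid [] v fun w' hw => ?_
  obtain rfl : w = w' := hw
  exact h

theorem shifted {i k : ℕ} (h : Eqv S k A B) (hw : w = i + k) :
    Eqv S w (shift i A) (shift i B) := by
  have := congr (S := S) (w := w) (i := i) (A := A) (B := B) [] [] fun w' hw' =>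
    ⟨k, (show w = w' from hw').symm.trans hw, h⟩
  simpa using this

/-! ### Interchange -/

theorem exchange (s t : Event) {i j k g : ℕ} (hj : j = i + s.top + g) (hk : k = i + s.bot + g) :
    Eqv S w [⟨s, i⟩, ⟨t, j⟩] [⟨t, k⟩, ⟨s, i⟩] := by
  subst hj hk
  have := of_isotopy (S := S) (w := w) i (PlaneIsotopy.exchange s t g) (fun n => by
    simp only [shift, List.map_cons, List.map_nil, IsDiagram]
    omega)
  simpa [shift, add_assoc] using this

theorem slice_interchange {a a' i j k g : ℕ} (t : Event) (hA : IsDiagram a A a')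
    (hj : j = i + a' + g) (hk : k = i + a + g) :
    Eqv S w (shift i A ++ [⟨t, j⟩]) (⟨t, k⟩ :: shift i A) := by
  induction A generalizing a w k with
  | nil =>
    obtain rfl : a = a' := hA
    subst hj hk
    exact refl _
  | cons s A ih =>
    obtain ⟨h₁, h₂⟩ := hA
    have e₁ := append_left (S := S) (w := w) [⟨s.event, i + s.pos⟩] fun w' _ =>
      ih (w := w') h₂ rfl
    -- The gap between the two events consists of the strands of `A` to the right of `s` and the `g`
    -- further ones.
    have e₂ := append_right (w := w) (S := S) (shift i A)
      (exchange (w := w) s.event t (i := i + s.pos)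
        (j := i + (a - s.event.bot + s.event.top) + g) (k := k)
        (g := a - s.event.bot - s.pos + g) (by omega) (by omega))
    exact e₁.trans e₂

/-- Stacks that are horizontally disjoint exchange their heights. -/
theorem interchange {a a' i j k : ℕ} (g : ℕ) (hA : IsDiagram a A a') (B : Stack)
    (hj : j = i + a' + g) (hk : k = i + a + g) :
    Eqv S w (shift i A ++ shift j B) (shift k B ++ shift i A) := by
  induction B generalizing w with
  | nil => simpa [shift] using refl (shift i A)
  | cons t B ih =>
    have e₁ := append_right (w := w) (S := S) (shift j B)
      (slice_interchange (i := i) (j := j + t.pos) (k := k + t.pos) (g := g + t.pos) t.event hA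
        (by omega) (by omega))
    have e₂ := append_left (S := S) (w := w) [⟨t.event, k + t.pos⟩] fun w' _ => ih (w := w')
    refine trans ?_ (trans e₂ (of_eq ?_))
    · simpa [shift] using e₁
    · simp [shift]

end Eqv

/-! ### Cables -/

theorem shift_cableCup (j n i : ℕ) : shift j (cableCup n i) = cableCup n (j + i) := by
  simp [shift, cableCup, Slice.cup, Function.comp_def, add_assoc]

theorem shift_cableCap (j n i : ℕ) : shift j (cableCap n i) = cableCap n (j + i) := by
  simp [shift, cableCap, Slice.cap, Function.comp_def, add_assoc]

theorem shift_cableCross (j : ℕ) (b : Bool) (k l i : ℕ) :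
    shift j (cableCross b k l i) = cableCross b k l (j + i) := by
  simp [shift, cableCross, Slice.cross, Function.comp_def, List.map_flatMap, add_assoc]

theorem shift_slice (j : ℕ) (e : Event) (i : ℕ) : shift j [⟨e, i⟩] = [⟨e, j + i⟩] := rfl

theorem shift_cup (j i : ℕ) : shift j [Slice.cup i] = [Slice.cup (j + i)] := rfl

theorem shift_cap (j i : ℕ) : shift j [Slice.cap i] = [Slice.cap (j + i)] := rfl

theorem shift_cross (j : ℕ) (b : Bool) (i : ℕ) :
    shift j [Slice.cross b i] = [Slice.cross b (j + i)] := rfl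

theorem cableCup_succ (n i : ℕ) :
    cableCup (n + 1) i = [Slice.cup i] ++ cableCup n (i + 1) := by
  simp [cableCup, List.range_succ_eq_map, Function.comp_def, add_assoc, add_comm 1]

theorem cableCap_succ (n i : ℕ) :
    cableCap (n + 1) i = cableCap n (i + 1) ++ [Slice.cap i] := by
  simp [cableCap, List.range_succ_eq_map, Function.comp_def, add_assoc, add_comm 1]

theorem cableCross_one_one (b : Bool) (i : ℕ) : cableCross b 1 1 i = [Slice.cross b i] := rfl

/-- An equality of lists, since the strands of the left cable cross one after another, the rightmost
one first. -/
theorem cableCross_add_left (b : Bool) (j k l i : ℕ) :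
    cableCross b (j + k) l i = cableCross b k l (i + j) ++ cableCross b j l i := by
  simp [cableCross, List.range_add, List.flatMap_map, add_assoc, ← List.map_reverse]

theorem cableCross_one_add (b : Bool) (l l' i : ℕ) :
    cableCross b 1 (l + l') i = cableCross b 1 l i ++ cableCross b 1 l' (i + l) := by
  simp [cableCross, List.range_add, Function.comp_def, add_assoc]

/-- Positions are counted from the left, so strands added on the right leave the stack unchanged. -/
theorem IsDiagram.widen {m n : ℕ} {A : Stack} (h : IsDiagram m A n) (r : ℕ) :
    IsDiagram (m + r) A (n + r) := by
  induction A generalizing m with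
  | nil => exact congrArg (· + r) h
  | cons s A ih =>
    obtain ⟨h₁, h₂⟩ := h
    have := ih h₂
    rw [show m - s.event.bot + s.event.top + r = m + r - s.event.bot + s.event.top by omega]
      at this
    exact ⟨by omega, this⟩

theorem isDiagram_cableCup {n i w : ℕ} (h : i ≤ w) :
    IsDiagram w (cableCup n i) (w + 2 * n) := by
  induction n generalizing i w with
  | zero => exact rfl
  | succ n ih =>
    rw [cableCup_succ]
    have := ih (i := i + 1) (w := w + 2) (by omega)
    rw [show w + 2 + 2 * n = w + 2 * (n + 1) by omega] at this
    exact ⟨h, this⟩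

theorem isDiagram_cableCap {n i w : ℕ} (h : i ≤ w) :
    IsDiagram (w + 2 * n) (cableCap n i) w := by
  induction n generalizing i w with
  | zero => exact rfl
  | succ n ih =>
    rw [cableCap_succ]
    have := ih (i := i + 1) (w := w + 2) (by omega)
    rw [show w + 2 + 2 * n = w + 2 * (n + 1) by omega] at this
    refine this.append ⟨?_, rfl⟩
    simp only [Slice.cap, Event.bot]
    omega

theorem isDiagram_cableCross_one {b : Bool} {l i w : ℕ} (h : i + 1 + l ≤ w) :
    IsDiagram w (cableCross b 1 l i) w := by
  induction l with
  | zero => exact rfl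
  | succ l ih =>
    rw [cableCross_one_add]
    refine (ih (by omega)).append ⟨?_, ?_⟩
    · change i + l + 0 + 0 + 2 ≤ w
      omega
    · change w - 2 + 2 = w
      omega

theorem isDiagram_cableCross {b : Bool} {k l i w : ℕ} (h : i + k + l ≤ w) :
    IsDiagram w (cableCross b k l i) w := by
  induction k with
  | zero => exact rfl
  | succ k ih =>
    rw [cableCross_add_left]
    exact (isDiagram_cableCross_one (by omega)).append (ih (by omega))

theorem isDiagram_cableCurl (n : ℕ) (b r : Bool) : IsDiagram n (cableCurl n b r) n := by
  cases r
  · exact ((isDiagram_cableCup (Nat.zero_le n)).append (isDiagram_cableCross (by omega))).append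
      (isDiagram_cableCap (Nat.zero_le n))
  · exact ((isDiagram_cableCup le_rfl).append (isDiagram_cableCross (by omega))).append
      (isDiagram_cableCap le_rfl)

theorem width_cableCross {b : Bool} {k l i w w' : ℕ} (h : IsDiagram w (cableCross b k l i) w') :
    w' = w := by
  suffices ∀ d : Stack, (∀ s ∈ d, ∃ b i, s = Slice.cross b i) → ∀ w, IsDiagram w d w' → w' = w by
    refine this _ (fun s hs => ?_) w h
    simp only [cableCross, List.mem_flatMap, List.mem_map] at hs
    obtain ⟨x, -, y, -, rfl⟩ := hs
    exact ⟨_, _, rfl⟩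
  intro d
  induction d with
  | nil => exact fun _ w h => Eq.symm h
  | cons s d ih =>
    intro hd w h
    obtain ⟨c, j, rfl⟩ := hd s (by simp)
    have := ih (fun t ht => hd t (by simp [ht])) _ h.2
    have h₁ := h.1
    simp only [Slice.cross, Event.bot, Event.top] at this h₁
    omega

namespace Eqv

variable {S : Set Move} {w : ℕ}

/-! ### Elementary equivalences at any position -/

theorem zigzag_left {i j : ℕ} (hj : j = i + 1) (h : i + 1 ≤ w) :
    Eqv S w [Slice.cup j, Slice.cap i] [] := by
  subst hj
  refine of_isotopy (S := S) (w := w) i PlaneIsotopy.zigzag_left (fun n => ?_)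
  simp only [shift, List.map_cons, List.map_nil, IsDiagram, Slice.cup, Slice.cap, Event.bot,
    Event.top]
  omega

theorem zigzag_right {i j : ℕ} (hj : j = i + 1) (h : i + 1 ≤ w) :
    Eqv S w [Slice.cup i, Slice.cap j] [] := by
  subst hj
  refine of_isotopy (S := S) (w := w) i PlaneIsotopy.zigzag_right (fun n => ?_)
  simp only [shift, List.map_cons, List.map_nil, IsDiagram, Slice.cup, Slice.cap, Event.bot,
    Event.top]
  omega

theorem rotate_cap (b : Bool) {i j : ℕ} (hj : j = i + 1) :
    Eqv S w [Slice.cross b j, Slice.cap i] [Slice.cross (!b) i, Slice.cap j] := by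
  subst hj
  refine of_isotopy (S := S) (w := w) i (PlaneIsotopy.rotate_cap b) (fun n => ?_)
  simp only [shift, List.map_cons, List.map_nil, IsDiagram, Slice.cross, Slice.cap, Event.bot,
    Event.top]
  omega

theorem rotate_cup (b : Bool) {i j : ℕ} (hj : j = i + 1) :
    Eqv S w [Slice.cup i, Slice.cross b j] [Slice.cup j, Slice.cross (!b) i] := by
  subst hj
  refine of_isotopy (S := S) (w := w) i (PlaneIsotopy.rotate_cup b) (fun n => ?_)
  simp only [shift, List.map_cons, List.map_nil, IsDiagram, Slice.cross, Slice.cup, Event.bot,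
    Event.top]
  omega

theorem cross_cancel (h2 : Move.K2 ∈ S) {b c : Bool} (hc : c = !b) {i : ℕ} (h : i + 2 ≤ w) :
    Eqv S w [Slice.cross b i, Slice.cross c i] [] := by
  subst hc
  refine of_move (S := S) (w := w) h2 i (Move.Pieces.K2 b) (fun n => ?_)
  simp only [shift, List.map_cons, List.map_nil, IsDiagram, Slice.cross, Event.bot, Event.top]
  omega

theorem cross_slide (h3 : Move.K3 ∈ S) (b c : Bool) {i j : ℕ} (hj : j = i + 1) :
    Eqv S w [Slice.cross c j, Slice.cross b i, Slice.cross b j]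
      [Slice.cross b i, Slice.cross b j, Slice.cross c i] := by
  subst hj
  refine (of_move (S := S) (w := w) h3 i (Move.Pieces.K3 b b c (Or.inl rfl)) (fun n => ?_)).symm
  simp only [shift, List.map_cons, List.map_nil, IsDiagram, Slice.cross, Event.bot, Event.top]
  omega

/-! ### A strand slides across a stack -/

theorem cableCross_event_slide (h2 : Move.K2 ∈ S) (h3 : Move.K3 ∈ S) (b : Bool) (e : Event)
    {i j : ℕ} (hj : j = i + 1) (hw : j + e.bot ≤ w) :
    Eqv S w ([⟨e, j⟩] ++ cableCross b 1 e.top i) (cableCross b 1 e.bot i ++ [⟨e, i⟩]) := by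
  cases e with
  | cup =>
    -- Rotating a crossing past the minimum reverses its type. The crossings of the strand with the
    -- two arms thus become opposite, and `K2` removes them.
    have e₁ : Eqv S w [Slice.cup i, Slice.cross (!b) j, Slice.cross b j]
        [Slice.cup j, Slice.cross b i, Slice.cross b j] := by
      simpa using append_right (w := w) (S := S) [Slice.cross b j] (rotate_cup (!b) hj)
    have e₂ := append_left (w := w) (S := S) [Slice.cup i] (A := [Slice.cross (!b) j,
      Slice.cross b j]) (B := []) fun w' hw' => by
        obtain ⟨-, rfl⟩ := hw'
        exact cross_cancel h2 (by simp) (by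
          simp only [Slice.cup, Event.bot, Event.top] at *; omega)
    subst hj
    exact e₁.symm.trans e₂
  | cap =>
    have e₁ := append_left (w := w) (S := S) [Slice.cross b i] fun w' _ => rotate_cap (w := w') b hj
    have e₂ := append_right (w := w) (S := S) [Slice.cap j] (cross_cancel (w := w) h2 (b := b) rfl
      (i := i) (by simp only [Event.bot] at *; omega))
    subst hj
    exact (e₁.trans e₂).symm
  | cross c =>
    subst hj
    exact cross_slide h3 b c rfl

/-- Only the crossings with the ends of the event need moves. Those with the `p` strands to its left
and the `q` strands to its right are disjoint from the event and exchange heights with it. -/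
theorem cableCross_slice_slide (h2 : Move.K2 ∈ S) (h3 : Move.K3 ∈ S) (b : Bool) (e : Event)
    {p q i : ℕ} (hw : i + 1 + p + e.bot ≤ w) :
    Eqv S w ([⟨e, i + 1 + p⟩] ++ cableCross b 1 (p + e.top + q) i)
      (cableCross b 1 (p + e.bot + q) i ++ [⟨e, i + p⟩]) := by
  have d₁ := isDiagram_cableCross_one (b := b) (l := p) (i := 0) (w := 1 + p) (by omega)
  have e₁ : Eqv S w ([⟨e, i + 1 + p⟩] ++ cableCross b 1 p i)
      (cableCross b 1 p i ++ [⟨e, i + 1 + p⟩]) := by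
    simpa [shift_cableCross, shift_slice] using (interchange (S := S) (w := w) (i := i)
      (j := i + 1 + p) (k := i + 1 + p) 0 d₁ [⟨e, 0⟩] (by omega) (by omega)).symm
  have e₂ : ∀ w', Eqv S w' ([⟨e, i + p⟩] ++ cableCross b 1 q (i + p + e.top))
      (cableCross b 1 q (i + p + e.bot) ++ [⟨e, i + p⟩]) := by
    intro w'
    have d₂ : IsDiagram e.bot [⟨e, 0⟩] e.top := ⟨by simp, by simp [IsDiagram]⟩
    simpa [shift_cableCross, shift_slice] using (interchange (S := S) (w := w') (i := i + p)
      (j := i + p + e.top) (k := i + p + e.bot) 0 d₂ (cableCross b 1 q 0) rfl rfl)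
  have f₁ := append_right (cableCross b 1 (e.top) (i + p) ++
    cableCross b 1 q (i + p + e.top)) e₁
  have f₂ := mid (S := S) (w := w) (cableCross b 1 p i) (cableCross b 1 q (i + p + e.top))
    fun w' hw' => cableCross_event_slide h2 h3 b e (i := i + p) (j := i + 1 + p) (w := w')
      (by omega) (by rw [width_cableCross hw']; exact hw)
  have f₃ := append_left (S := S) (w := w) (cableCross b 1 p i ++ cableCross b 1 e.bot (i + p))
    fun w' _ => e₂ w'
  rw [cableCross_one_add, cableCross_one_add, cableCross_one_add, cableCross_one_add]
  simp only [List.append_assoc, ← add_assoc] at f₁ f₂ f₃ ⊢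
  exact (f₁.trans f₂).trans f₃

theorem cableCross_slide (h2 : Move.K2 ∈ S) (h3 : Move.K3 ∈ S) (b : Bool) {A : Stack}
    {l l' i j : ℕ} (hA : IsDiagram l A l') (hj : j = i + 1) (hw : j + l ≤ w) :
    Eqv S w (shift j A ++ cableCross b 1 l' i) (cableCross b 1 l i ++ shift i A) := by
  subst hj
  induction A generalizing l w with
  | nil =>
    obtain rfl : l = l' := hA
    simpa [shift] using refl (cableCross b 1 l i)
  | cons s A ih =>
    obtain ⟨h₁, h₂⟩ := hA
    obtain ⟨q, rfl⟩ := Nat.exists_eq_add_of_le h₁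
    rw [show s.pos + s.event.bot + q - s.event.bot + s.event.top = s.pos + s.event.top + q by
      omega] at h₂
    have e₁ := append_left (S := S) (w := w) [⟨s.event, i + 1 + s.pos⟩] fun w' hw' =>
      ih (w := w') h₂ (by
        obtain ⟨-, rfl⟩ := hw'
        simp only
        omega)
    have e₂ := append_right (S := S) (shift i A) (cableCross_slice_slide (w := w) h2 h3 b s.event
      (p := s.pos) (q := q) (i := i) (by omega))
    simp only [List.append_assoc] at e₁ e₂
    simpa [shift] using e₁.trans e₂

/-! ### Crossings of cables -/

/-- The crossings cancel in pairs from the middle outwards. -/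
theorem cableCross_cancel (h2 : Move.K2 ∈ S) {b c : Bool} (hc : c = !b) {k i : ℕ}
    (hw : i + k + 1 ≤ w) : Eqv S w (cableCross b k 1 i ++ cableCross c 1 k i) [] := by
  induction k generalizing i with
  | zero => exact refl _
  | succ k ih =>
    rw [add_comm k 1, cableCross_add_left, cableCross_one_add, cableCross_one_one,
      cableCross_one_one]
    have e := mid (S := S) (w := w) (cableCross b k 1 (i + 1)) (cableCross c 1 k (i + 1))
      fun w' hw' => cross_cancel h2 hc (i := i) (w := w') (by
        rw [width_cableCross hw']; omega)
    simp only [List.append_assoc, List.cons_append, List.nil_append] at e ⊢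
    exact e.trans (ih (by omega))

theorem cableCross_cancel' (h2 : Move.K2 ∈ S) {b c : Bool} (hc : c = !b) {k i : ℕ}
    (hw : i + k + 1 ≤ w) : Eqv S w (cableCross b 1 k i ++ cableCross c k 1 i) [] := by
  induction k with
  | zero => exact refl _
  | succ k ih =>
    rw [add_comm k 1, add_comm 1 k, cableCross_add_left, cableCross_one_add, cableCross_one_one,
      cableCross_one_one]
    have e := mid (S := S) (w := w) (cableCross b 1 k i) (cableCross c k 1 i)
      fun w' hw' => cross_cancel h2 hc (i := i + k) (w := w') (by
        rw [width_cableCross hw']; omega)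
    simp only [List.append_assoc, List.cons_append, List.nil_append] at e ⊢
    exact e.trans (ih (by omega))

/-- A strand to the right of a stack slides across it. -/
theorem cableCross_slide_right (h2 : Move.K2 ∈ S) (h3 : Move.K3 ∈ S) (b : Bool) {A : Stack}
    {l l' i j : ℕ} (hA : IsDiagram l A l') (hj : j = i + 1) (hw : j + l ≤ w) :
    Eqv S w (shift i A ++ cableCross b l' 1 i) (cableCross b l 1 i ++ shift j A) := by
  obtain ⟨r, rfl⟩ := Nat.exists_eq_add_of_le hw
  have d : IsDiagram (j + l + r) (shift j A) (j + l' + r) := by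
    rw [add_assoc, add_assoc]
    exact isDiagram_shift.2 (hA.widen r)
  -- The slide of a strand on the left is conjugated: a cancelling pair of crossings is inserted
  -- below, its upper half slides up across `A`, and there it cancels against the given crossings.
  have e₁ := append_right (shift i A ++ cableCross b l' 1 i)
    (cableCross_cancel (w := j + l + r) (S := S) h2 (b := b) rfl (k := l) (i := i) (by omega))
  have e₂ := mid (S := S) (w := j + l + r) (cableCross b l 1 i) (cableCross b l' 1 i)
    fun w' hw' => cableCross_slide (w := w') h2 h3 (!b) hA hj (by
      rw [width_cableCross hw']; omega)
  have e₃ := append_left (S := S) (w := j + l + r) (cableCross b l 1 i ++ shift j A)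
    fun w' hw' => cableCross_cancel' (w := w') h2 (b := !b) (c := b) (by simp) (k := l') (i := i)
      (by
        obtain ⟨x, hx, hx'⟩ := isDiagram_append.1 hw'
        obtain rfl := width_cableCross hx
        have := d.unique hx'
        omega)
  simp only [List.append_assoc, List.nil_append, List.append_nil] at e₁ e₂ e₃
  exact (e₁.symm.trans e₂.symm).trans e₃

/-- Crossings are listed along the strands of the left cable. Splitting the right cable reorders
distant crossings, so this is an isotopy and not an equality. -/
theorem cableCross_add_right (b : Bool) (k l l' i : ℕ) :
    Eqv S w (cableCross b k (l + l') i) (cableCross b k l i ++ cableCross b k l' (i + l)) := by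
  induction k generalizing w with
  | zero => exact refl _
  | succ k ih =>
    rw [cableCross_add_left, cableCross_add_left, cableCross_add_left, cableCross_one_add]
    have e₁ := append_left (S := S) (w := w)
      (cableCross b 1 l (i + k) ++ cableCross b 1 l' (i + k + l)) fun w' _ => ih (w := w')
    have e₂ := mid (S := S) (w := w) (cableCross b 1 l (i + k)) (cableCross b k l' (i + l))
      fun w' _ => (interchange (S := S) (w := w') (i := i) (j := i + k + l) (k := i + k + l)
        (a := k + l) (a' := k + l) 0
        (isDiagram_cableCross (b := b) (k := k) (l := l) (i := 0) (by omega))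
        (cableCross b 1 l' 0) (by omega) (by omega)).symm
    simp only [List.append_assoc, shift_cableCross, add_zero, add_right_comm i l k] at e₁ e₂ ⊢
    exact e₁.trans e₂

/-! ### Peeling one strand off the curl of a cable -/

theorem cableCurl_succ_right (h2 : Move.K2 ∈ S) (h3 : Move.K3 ∈ S) (b : Bool) (n : ℕ)
    (hw : n + 1 ≤ w) :
    Eqv S w (cableCurl (n + 1) b true)
      (cableCross b 1 n 0 ++ (shift n (curl b true) ++
        (cableCross b n 1 0 ++ shift 1 (cableCurl n b true)))) := by
  have hθ := isDiagram_cableCurl n b true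
  have eθ : shift 2 (cableCurl n b true) =
      cableCup n (n + 2) ++ (cableCross b n n 2 ++ cableCap n (n + 2)) := by
    simp [cableCurl, shift_append, shift_cableCup, shift_cableCap, shift_cableCross, add_comm n]
  -- The square of crossings splits into `n * 1`, `n * n`, `1 * 1` and `1 * n` blocks.
  have e₀ : Eqv S w (cableCurl (n + 1) b true)
      ([Slice.cup (n + 1)] ++ (cableCup n (n + 2) ++ (cableCross b n 1 1 ++
        (cableCross b n n 2 ++ ([Slice.cross b 0] ++ (cableCross b 1 n 1 ++
          (cableCap n (n + 2) ++ [Slice.cap (n + 1)]))))))) := by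
    have e := mid (S := S) (w := w) (cableCup (n + 1) (n + 1))
      (cableCross b 1 (1 + n) 0 ++ cableCap (n + 1) (n + 1))
      fun w' _ => cableCross_add_right (w := w') b n 1 n 1
    refine (of_eq ?_).trans (e.trans (of_eq ?_))
    · rw [cableCurl, if_pos rfl, add_comm n 1, cableCross_add_left b 1 n]
      simp
    · rw [cableCross_one_add, cableCup_succ, cableCap_succ, cableCross_one_one]
      simp
  have e₁ := mid (S := S) (w := w) [Slice.cup (n + 1)] (cableCross b n n 2 ++
    ([Slice.cross b 0] ++ (cableCross b 1 n 1 ++ (cableCap n (n + 2) ++ [Slice.cap (n + 1)]))))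
    fun w' _ => (interchange (S := S) (w := w') (i := 1) (j := n + 2) (k := n + 2)
      (a := n + 1) (a' := n + 1) 0 (isDiagram_cableCross (b := b) (k := n) (l := 1) (i := 0)
        (by omega)) (cableCup n 0) (by omega) (by omega)).symm
  have e₂ := mid (S := S) (w := w) ([Slice.cup (n + 1)] ++ (cableCross b n 1 1 ++
      (cableCup n (n + 2) ++ cableCross b n n 2))) [Slice.cap (n + 1)]
    fun w' _ => interchange (S := S) (w := w') (i := 0) (j := n + 2) (k := n + 2)
      (a := n + 2) (a' := n + 2) 0
      (A := [Slice.cross b 0] ++ cableCross b 1 n 1)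
      (IsDiagram.append (k := n + 2) ⟨by simp [Slice.cross, Event.bot], rfl⟩
        (isDiagram_cableCross_one (by omega)))
      (cableCap n 0) (by omega) (by omega)
  have e₃ := mid (S := S) (w := w) ([Slice.cup (n + 1)] ++ cableCross b n 1 1)
    (cableCross b 1 n 1 ++ [Slice.cap (n + 1)])
    fun w' _ => (interchange (S := S) (w := w') (i := 0) (j := 2) (k := 2)
      (a := 2) (a' := 2) 0 (A := [Slice.cross b 0]) ⟨le_rfl, rfl⟩
      (cableCurl n b true) (by omega) (by omega)).symm
  -- The curl of the inner `n`-cable is now a contiguous piece. The loop of the outer strand slides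
  -- across it and leaves it on top.
  have e₄ := mid (S := S) (w := w) ([Slice.cup (n + 1)] ++ (cableCross b n 1 1 ++
      [Slice.cross b 0])) [Slice.cap (n + 1)]
    fun w' hw' => cableCross_slide (w := w') h2 h3 b hθ (i := 1) (j := 2) rfl (by
      obtain ⟨x, ⟨-, rfl⟩, hx⟩ := isDiagram_append.1 hw'
      obtain ⟨y, hy, hz, rfl⟩ := isDiagram_append.1 hx
      obtain rfl := width_cableCross hy
      simp only [Slice.cup, Slice.cross, Event.bot, Event.top]
      omega)
  have e₅ := append_left (S := S) (w := w) ([Slice.cup (n + 1)] ++ (cableCross b n 1 1 ++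
      ([Slice.cross b 0] ++ cableCross b 1 n 1)))
    fun w' _ => interchange (S := S) (w := w') (i := 1) (j := n + 1) (k := n + 1) 0 hθ
      [Slice.cap 0] (by omega) (by omega)
  -- Here the sliding strand crosses `n + 1` others, and the piece it passes is their own block of
  -- crossings. Afterwards the self-crossing of the outer strand is at position `n`, right of the
  -- cable.
  have e₆ := mid (S := S) (w := w) [Slice.cup (n + 1)]
    ([Slice.cap (n + 1)] ++ shift 1 (cableCurl n b true))
    fun w' hw' => cableCross_slide (w := w') h2 h3 b (i := 0) (j := 1) (l := n + 1) (l' := 1 + n)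
      (A := cableCross b n 1 0) (by rw [add_comm 1]; exact isDiagram_cableCross (by omega)) rfl (by
      obtain ⟨-, rfl⟩ := hw'
      simp only [Slice.cup, Event.bot, Event.top]
      omega)
  have e₇ := append_right (S := S) (w := w) ([Slice.cross b n] ++ (cableCross b n 1 0 ++
      ([Slice.cap (n + 1)] ++ shift 1 (cableCurl n b true))))
    (interchange (S := S) (w := w) (i := 0) (j := n + 1) (k := n + 1)
      (a := n + 1) (a' := n + 1) 0 (isDiagram_cableCross_one (b := b) (l := n) (i := 0)
        (by omega)) [Slice.cup 0] (by omega) (by omega)).symm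
  have e₈ := mid (S := S) (w := w) (cableCross b 1 n 0 ++ ([Slice.cup (n + 1)] ++
      [Slice.cross b n])) (shift 1 (cableCurl n b true))
    fun w' _ => interchange (S := S) (w := w') (i := 0) (j := n + 1) (k := n + 1)
      (a := n + 1) (a' := n + 1) 0 (isDiagram_cableCross (b := b) (k := n) (l := 1) (i := 0)
        (by omega)) [Slice.cap 0] (by omega) (by omega)
  have ec : shift n (curl b true) = [Slice.cup (n + 1)] ++ ([Slice.cross b n] ++
      [Slice.cap (n + 1)]) := rfl
  rw [ec]
  rw [cableCross_one_add, cableCross_one_add, cableCross_one_one, cableCross_one_one] at e₆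
  simp only [eθ, shift_cableCross, shift_cableCup, shift_cableCap, shift_cup, shift_cap,
    shift_cross, shift_append, List.append_assoc, add_zero, zero_add]
    at e₀ e₁ e₂ e₃ e₄ e₅ e₆ e₇ e₈ ⊢
  exact e₀.trans <| e₁.trans <| e₂.trans <| e₃.trans <| e₄.trans <| e₅.trans <| e₆.trans <|
    e₇.trans e₈

theorem cableCurl_succ_left (h2 : Move.K2 ∈ S) (h3 : Move.K3 ∈ S) (b : Bool) (n : ℕ)
    (hw : n + 1 ≤ w) :
    Eqv S w (cableCurl (n + 1) b false)
      (cableCross b n 1 0 ++ (curl b false ++ (cableCross b 1 n 0 ++ cableCurl n b false))) := by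
  have hθ := isDiagram_cableCurl n b false
  have hcup : IsDiagram 0 (cableCup n 0) (2 * n) := by
    simpa using isDiagram_cableCup (n := n) (i := 0) (w := 0) le_rfl
  have hcap : IsDiagram (2 * n) (cableCap n 0) 0 := by
    simpa using isDiagram_cableCap (n := n) (i := 0) (w := 0) le_rfl
  have eθ : shift 1 (cableCurl n b false) =
      cableCup n 1 ++ (cableCross b n n (n + 1) ++ cableCap n 1) := by
    simp [cableCurl, shift_append, shift_cableCup, shift_cableCap, shift_cableCross, add_comm n]
  have e₀ : Eqv S w (cableCurl (n + 1) b false)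
      ([Slice.cup 0] ++ (cableCup n 1 ++ (cableCross b 1 n (n + 1 + n) ++
        ([Slice.cross b (n + 1 + n + n)] ++ (cableCross b n n (n + 1) ++
          (cableCross b n 1 (n + 1 + n) ++ (cableCap n 1 ++ [Slice.cap 0]))))))) := by
    have e := mid (S := S) (w := w)
      (cableCup (n + 1) 0 ++ cableCross b 1 (n + 1) (n + 1 + n)) (cableCap (n + 1) 0)
      fun w' _ => cableCross_add_right (w := w') b n n 1 (n + 1)
    refine (of_eq ?_).trans (e.trans (of_eq ?_))
    · simp [cableCurl, cableCross_add_left b n 1]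
    · rw [cableCross_one_add, cableCup_succ, cableCap_succ, cableCross_one_one]
      simp
  have e₁ := mid (S := S) (w := w) [Slice.cup 0] (cableCross b n n (n + 1) ++
          (cableCross b n 1 (n + 1 + n) ++ (cableCap n 1 ++ [Slice.cap 0])))
    fun w' _ => interchange (S := S) (w := w') (i := 1) (j := n + 1 + n) (k := 1)
      0 hcup (cableCross b 1 n 0 ++ [Slice.cross b n])
      (by omega) (by omega)
  have e₂ := mid (S := S) (w := w) ([Slice.cup 0] ++ (cableCross b 1 n 1 ++
      ([Slice.cross b (1 + n)] ++ (cableCup n 1 ++ cableCross b n n (n + 1))))) [Slice.cap 0]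
    fun w' _ => (interchange (S := S) (w := w') (i := 1) (j := 1) (k := n + 1 + n)
      0 hcap (cableCross b n 1 0) (by omega) (by omega)).symm
  -- The loop of the outer strand now passes to the right of the inner curl, so the slide from the
  -- right is used.
  have e₃ := mid (S := S) (w := w) ([Slice.cup 0] ++ (cableCross b 1 n 1 ++
      [Slice.cross b (1 + n)])) [Slice.cap 0]
    fun w' hw' => cableCross_slide_right (w := w') h2 h3 b hθ (i := 1) (j := 2) rfl (by
      obtain ⟨x, ⟨-, rfl⟩, hx⟩ := isDiagram_append.1 hw'
      obtain ⟨y, hy, hz, rfl⟩ := isDiagram_append.1 hx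
      obtain rfl := width_cableCross hy
      simp only [Slice.cup, Slice.cross, Event.bot, Event.top]
      omega)
  have e₄ := append_left (S := S) (w := w) ([Slice.cup 0] ++ (cableCross b 1 n 1 ++
      ([Slice.cross b (1 + n)] ++ cableCross b n 1 1)))
    fun w' _ => (interchange (S := S) (w := w') (i := 0) (j := 0) (k := 2)
      (a := 2) (a' := 0) 0 (A := [Slice.cap 0]) ⟨le_rfl, rfl⟩
      (cableCurl n b false) (by omega) (by omega)).symm
  have e₅ := mid (S := S) (w := w) [Slice.cup 0] ([Slice.cap 0] ++ cableCurl n b false)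
    fun w' hw' => (cableCross_slide (w := w') h2 h3 b (i := 1) (j := 2) (l := n + 1) (l' := 1 + n)
      (A := cableCross b n 1 0) (by rw [add_comm 1]; exact isDiagram_cableCross (by omega)) rfl (by
      obtain ⟨-, rfl⟩ := hw'
      simp only [Slice.cup, Event.bot, Event.top]
      omega)).symm
  have e₆ := append_right (S := S) (w := w) ([Slice.cross b 1] ++ (cableCross b 1 n 2 ++
      ([Slice.cap 0] ++ cableCurl n b false)))
    (interchange (S := S) (w := w) (i := 0) (j := 2) (k := 0)
      (a := 0) (a' := 2) 0 (A := [Slice.cup 0]) ⟨le_rfl, rfl⟩ (cableCross b n 1 0) rfl rfl)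
  have e₇ := mid (S := S) (w := w) (cableCross b n 1 0 ++ ([Slice.cup 0] ++
      [Slice.cross b 1])) (cableCurl n b false)
    fun w' _ => (interchange (S := S) (w := w') (i := 0) (j := 0) (k := 2)
      (a := 2) (a' := 0) 0 (A := [Slice.cap 0]) ⟨le_rfl, rfl⟩ (cableCross b 1 n 0) rfl rfl).symm
  have ec : curl b false = [Slice.cup 0] ++ ([Slice.cross b 1] ++ [Slice.cap 0]) := rfl
  rw [ec]
  rw [cableCross_one_add, cableCross_one_add, cableCross_one_one, cableCross_one_one] at e₅
  simp only [eθ, shift_cableCross, shift_cableCup, shift_cableCap, shift_cup, shift_cap,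
    shift_cross, shift_append, shift_zero, List.append_assoc, add_zero,
    Nat.reduceAdd] at e₀ e₁ e₂ e₃ e₄ e₅ e₆ e₇ ⊢
  exact e₀.trans <| e₁.trans <| e₂.trans <| e₃.trans <| e₄.trans <| e₅.trans <| e₆.trans e₇

/-! ### Cancellation of opposite curls -/

/-- The Whitney trick. -/
theorem curl_whitney (h2 : Move.K2 ∈ S) (h3 : Move.K3 ∈ S) {b c : Bool} (hc : c = !b)
    (hw : 1 ≤ w) : Eqv S w (curl b true ++ curl c false) [] := by
  subst hc
  have hX := isDiagram_cableCurl 1 (!b) false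
  -- The second curl is pushed below the maximum of the first one and through its crossing, onto the
  -- left arm of the first minimum.
  have e₁ := append_left (S := S) (w := w) ([Slice.cup 1] ++ [Slice.cross b 0])
    fun w' _ => (interchange (S := S) (w := w') (i := 0) (j := 1) (k := 1) 0 hX [Slice.cap 0]
      rfl rfl).symm
  have e₂ := mid (S := S) (w := w) [Slice.cup 1] [Slice.cap 1]
    fun w' hw' => (cableCross_slide (w := w') h2 h3 b hX (i := 0) (j := 1) rfl (by
      obtain ⟨-, rfl⟩ := hw'
      simp only [Slice.cup, Event.bot, Event.top]
      omega)).symm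
  -- This rotation opens the inner curl into one crossing of type `b` and a zigzag. After
  -- straightening, a rotation of the other crossing makes it `!b`, so that `K2` applies.
  have e₃ := mid (S := S) (w := w) ([Slice.cup 1] ++ [Slice.cup 1])
    ([Slice.cross b 0] ++ [Slice.cap 1]) fun w' _ => rotate_cap (w := w') (!b) (i := 1) rfl
  have e₄ := append_right (S := S) (w := w)
    ([Slice.cross b 1] ++ ([Slice.cap 2] ++ ([Slice.cross b 0] ++ [Slice.cap 1])))
    (exchange (w := w) Event.cup Event.cup (i := 1) (j := 3) (k := 1) (g := 0) rfl rfl).symm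
  have e₅ := mid (S := S) (w := w) [Slice.cup 1] ([Slice.cap 2] ++ ([Slice.cross b 0] ++
      [Slice.cap 1])) fun w' _ => exchange (w := w') (Event.cross b) Event.cup (i := 1) (j := 3)
    (k := 3) (g := 0) rfl rfl
  have e₆ := mid (S := S) (w := w) ([Slice.cup 1] ++ [Slice.cross b 1]) ([Slice.cross b 0] ++
      [Slice.cap 1]) fun w' hw' => zigzag_left (w := w') (i := 2) (j := 3) rfl (by
    obtain ⟨x, ⟨-, rfl⟩, -, rfl⟩ := isDiagram_append.1 hw'
    simp only [Slice.cup, Slice.cross, Event.bot, Event.top]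
    omega)
  have e₇ := append_left (S := S) (w := w) ([Slice.cup 1] ++ [Slice.cross b 1])
    fun w' _ => (rotate_cap (w := w') (!b) (i := 0) rfl).symm
  have e₈ := mid (S := S) (w := w) [Slice.cup 1] [Slice.cap 0] fun w' hw' =>
    cross_cancel (w := w') h2 (b := b) rfl (i := 1) (by
      obtain ⟨-, rfl⟩ := hw'
      simp only [Slice.cup, Event.bot, Event.top]
      omega)
  have e₉ := zigzag_left (S := S) (w := w) (i := 0) rfl hw
  simp only [cableCross_one_one, Bool.not_not] at e₂ e₃ e₇
  exact e₁.trans <| e₂.trans <| e₃.trans <| e₄.trans <| e₅.symm.trans <| e₆.trans <|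
    e₇.trans <| e₈.trans e₉

theorem curl_cancel (h1 : Move.K1 ∈ S) (h2 : Move.K2 ∈ S) (h3 : Move.K3 ∈ S) (b r : Bool)
    (hw : 1 ≤ w) : Eqv S w (curl b r ++ curl (!b) r) [] := by
  have ribbon : ∀ c w', Eqv S w' (curl c true) (curl c false) := fun c w' => by
    have := of_move (S := S) (w := w') h1 0 (Move.Pieces.K1 c) (fun n => by
      simp only [curl, cableCurl, cableCup, cableCap, cableCross, shift, Slice.cup,
        Slice.cap, Slice.cross, List.range_succ, List.range_zero]
      simp [IsDiagram, Event.bot, Event.top])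
    simpa [shift_zero] using this
  -- The curl to be flipped is the one that leaves a right curl below a left one, as in the Whitney
  -- trick.
  cases r
  · exact (append_right _ (ribbon b w).symm).trans (curl_whitney h2 h3 rfl hw)
  · exact (append_left _ fun w' _ => ribbon (!b) w').trans (curl_whitney h2 h3 rfl hw)

/-- Conjugates of a cancelling pair cancel, together with a cancelling pair that commutes with
them. -/
theorem cancel_of_commute {X X' P Q P' Q' C C' Y Y' : Stack} (hX : ∀ w', w' = w →
      Eqv S w' X (P ++ (C ++ (Q ++ Y))))
    (hX' : ∀ w', w' = w → Eqv S w' X' (P' ++ (C' ++ (Q' ++ Y'))))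
    (dX : IsDiagram w X w) (hP : IsDiagram w P w) (hC : IsDiagram w C w) (hQ : IsDiagram w Q w)
    (comm : Eqv S w (Y ++ (P' ++ (C' ++ Q'))) (P' ++ (C' ++ (Q' ++ Y))))
    (hQP : Eqv S w (Q ++ P') []) (hCC : Eqv S w (C ++ C') []) (hPQ : Eqv S w (P ++ Q') [])
    (hY : Eqv S w (Y ++ Y') []) : Eqv S w (X ++ X') [] := by
  have e₁ := append_left X (S := S) (w := w) fun w' h => hX' w' (h.unique dX)
  have e₂ := append_right (P' ++ (C' ++ (Q' ++ Y'))) (hX w rfl)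
  have e₃ := mid (A := Y ++ (P' ++ (C' ++ Q'))) (B := P' ++ (C' ++ (Q' ++ Y))) (S := S) (w := w)
    (P ++ (C ++ Q)) Y' fun w' h => by
    obtain rfl := h.unique (hP.append (hC.append hQ))
    exact comm
  have e₄ := mid (A := Q ++ P') (B := []) (S := S) (w := w) (P ++ C) (C' ++ (Q' ++ (Y ++ Y'))) fun w' h => by
    obtain rfl := h.unique (hP.append hC)
    exact hQP
  have e₅ := mid (A := C ++ C') (B := []) (S := S) (w := w) P (Q' ++ (Y ++ Y')) fun w' h => by
    obtain rfl := h.unique hP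
    exact hCC
  have e₆ := append_right (Y ++ Y') hPQ
  simp only [List.append_assoc, List.nil_append] at e₁ e₂ e₃ e₄ e₅ e₆
  exact e₁.trans <| e₂.trans <| e₃.trans <| e₄.trans <| e₅.trans <| e₆.trans hY

theorem cableCurl_cancel (h1 : Move.K1 ∈ S) (h2 : Move.K2 ∈ S) (h3 : Move.K3 ∈ S) (b r : Bool)
    (n : ℕ) (hw : n ≤ w) : Eqv S w (cableCurl n b r ++ cableCurl n (!b) r) [] := by
  induction n generalizing w with
  | zero => cases r <;> exact refl _
  | succ n ih =>
    have hX : IsDiagram w (cableCurl (n + 1) b r) w := by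
      obtain ⟨q, rfl⟩ := Nat.exists_eq_add_of_le hw
      exact (isDiagram_cableCurl (n + 1) b r).widen q
    have hθ := isDiagram_cableCurl n b r
    have hO := isDiagram_cableCross (b := b) (k := 1) (l := n) (i := 0) (w := w) (by omega)
    have hU := isDiagram_cableCross (b := b) (k := n) (l := 1) (i := 0) (w := w) (by omega)
    have hO' := isDiagram_cableCross (b := !b) (k := 1) (l := n) (i := 0) (w := w) (by omega)
    have hU' := isDiagram_cableCross (b := !b) (k := n) (l := 1) (i := 0) (w := w) (by omega)
    -- The signs need not match: a strand whose crossings all have type `!b` slides across any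
    -- piece, in particular across the curl of sign `b`.
    have overSlide := cableCross_slide (S := S) (w := w) h2 h3 (!b) hθ (i := 0) (j := 1) rfl
      (by omega)
    have underSlide := cableCross_slide_right (S := S) (w := w) h2 h3 (!b) hθ (i := 0) (j := 1) rfl
      (by omega)
    rw [shift_zero] at overSlide underSlide
    cases r
    · have hC : ∀ c, IsDiagram w (curl c false) w := fun c => by
        obtain ⟨q, rfl⟩ := Nat.exists_eq_add_of_le hw
        have : IsDiagram (1 + (n + q)) (curl c false) (1 + (n + q)) :=
          (isDiagram_cableCurl 1 c false).widen (n + q)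
        rwa [show 1 + (n + q) = n + 1 + q by omega] at this
      refine cancel_of_commute (fun w' h => cableCurl_succ_left h2 h3 b n (h ▸ hw))
        (fun w' h => cableCurl_succ_left h2 h3 (!b) n (h ▸ hw)) hX hU (hC b) hO ?_
        (cableCross_cancel' h2 rfl (by omega)) (curl_cancel h1 h2 h3 b false (by omega))
        (cableCross_cancel h2 rfl (by omega)) (ih (by omega))
      -- The outgoing strand pushes the `n`-cable curl aside by one position, its own curl is
      -- disjoint from it, and the returning strand pushes it back.
      have c₁ := append_right (curl (!b) false ++ cableCross (!b) 1 n 0) underSlide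
      have c₂ := mid (S := S) (w := w) (cableCross (!b) n 1 0) (cableCross (!b) 1 n 0)
        fun w' _ => (interchange (S := S) (w := w') (i := 0) (j := 1) (k := 1) 0
          (isDiagram_cableCurl 1 (!b) false) (cableCurl n b false) rfl rfl).symm
      have c₃ := append_left (S := S) (w := w) (cableCross (!b) n 1 0 ++ curl (!b) false)
        fun w' h => by
          obtain rfl := h.unique (hU'.append (hC _))
          exact overSlide
      simp only [List.append_assoc, shift_zero] at c₁ c₂ c₃ ⊢
      exact c₁.trans (c₂.trans c₃)
    · have hC : ∀ c, IsDiagram w (shift n (curl c true)) w := fun c => by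
        obtain ⟨q, rfl⟩ := Nat.exists_eq_add_of_le hw
        rw [add_assoc]
        exact isDiagram_shift.2 ((isDiagram_cableCurl 1 c true).widen q)
      refine cancel_of_commute (fun w' h => cableCurl_succ_right h2 h3 b n (h ▸ hw))
        (fun w' h => cableCurl_succ_right h2 h3 (!b) n (h ▸ hw)) hX hO (hC b) hU ?_
        (cableCross_cancel h2 rfl (by omega)) ?_
        (cableCross_cancel' h2 rfl (by omega)) ?_
      · have c₁ := append_right (shift n (curl (!b) true) ++ cableCross (!b) n 1 0) overSlide
        have c₂ := mid (S := S) (w := w) (cableCross (!b) 1 n 0) (cableCross (!b) n 1 0)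
          fun w' _ => interchange (S := S) (w := w') (i := 0) (j := n) (k := n) 0
            hθ (curl (!b) true) (by omega) (by omega)
        have c₃ := append_left (S := S) (w := w) (cableCross (!b) 1 n 0 ++ shift n (curl (!b) true))
          fun w' h => by
            obtain rfl := h.unique (hO'.append (hC _))
            exact underSlide
        simp only [List.append_assoc, shift_zero] at c₁ c₂ c₃ ⊢
        exact c₁.trans (c₂.trans c₃)
      · rw [← shift_append]
        exact (curl_cancel (w := w - n) h1 h2 h3 b true (by omega)).shifted (by omega)
      · rw [← shift_append]
        exact (ih (w := w - 1) (by omega)).shifted (by omega)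

end Eqv

/-! ### From pieces to moves on diagrams -/

theorem le_of_isDiagram_cableCross_one {b : Bool} {l i w m : ℕ}
    (h : IsDiagram w (cableCross b 1 (l + 1) i) m) : i + l + 2 ≤ w := by
  rw [cableCross_one_add] at h
  obtain ⟨x, hx, h'⟩ := isDiagram_append.1 h
  obtain rfl := width_cableCross hx
  exact h'.1

/-- Needed because the other side of `K5` is the empty piece, which is valid at every width; the
bound must come from the curls. On the left it comes from the rightmost crossing, on the right from
the position of the first minimum. -/
theorem le_of_isDiagram_cableCurl {n k m : ℕ} {b r : Bool} (hn : 1 ≤ n)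
    (h : IsDiagram k (cableCurl n b r) m) : n ≤ k := by
  obtain ⟨n, rfl⟩ := Nat.exists_eq_add_of_le' hn
  cases r
  · obtain ⟨x, hx, -⟩ := isDiagram_append.1 h
    obtain ⟨y, hy, hz⟩ := isDiagram_append.1 hx
    obtain rfl := hy.unique (isDiagram_cableCup (Nat.zero_le k))
    rw [cableCross_add_left] at hz
    obtain ⟨z, hz, -⟩ := isDiagram_append.1 hz
    have := le_of_isDiagram_cableCross_one hz
    omega
  · have : Slice.pos (Slice.cup (n + 1 + 0)) + 0 ≤ k := by
      rw [cableCurl, if_pos rfl, cableCup_succ] at h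
      exact h.1
    exact this

theorem le_of_isDiagram_shift_of_ne_nil {A : Stack} (hA : A ≠ []) {i w m : ℕ}
    (h : IsDiagram w (shift i A) m) : i ≤ w := by
  cases A with
  | nil => exact absurd rfl hA
  | cons s A =>
    have : i + s.pos + s.event.bot ≤ w := h.1
    omega

theorem Connected.of_K5 {S : Set Move} (h1 : Move.K1 ∈ S) (h2 : Move.K2 ∈ S) (h3 : Move.K3 ∈ S)
    {n k l : ℕ} {A B : Diagram k l} (h : Move.Applies (Move.K5 n) A B) : Connected S A B := by
  have key : ∀ {A B : Diagram k l}, Replaces (Move.K5 n).Pieces A B → Connected S A B := by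
    rintro ⟨A, hA⟩ ⟨B, hB⟩ ⟨u, v, p, q, i, hp, rfl, rfl⟩
    cases hp with | K5 _ b r hn =>
    refine (Eqv.congr (S := S) (w := k) (i := i) u v (fun w' hw' => ?_) l).2 hA hB
    obtain ⟨x, hx, -⟩ := isDiagram_append.1 hA
    obtain ⟨w, hw, hc⟩ := isDiagram_append.1 hx
    obtain rfl := hw.unique hw'
    rw [shift_append] at hc
    obtain ⟨y, hy, -⟩ := isDiagram_append.1 hc
    -- A shifted piece forces `i` strands below it only if it contains an event.
    have hne : cableCurl n b r ≠ [] := fun h => by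
      obtain ⟨n', rfl⟩ := Nat.exists_eq_add_of_le' hn
      cases r <;> simp [cableCurl, cableCup_succ] at h
    obtain ⟨j, rfl⟩ := Nat.exists_eq_add_of_le (le_of_isDiagram_shift_of_ne_nil hne hy)
    obtain ⟨y, rfl⟩ := Nat.exists_eq_add_of_le (le_of_isDiagram_shift hy)
    exact ⟨j, rfl, Eqv.cableCurl_cancel h1 h2 h3 b r n
      (le_of_isDiagram_cableCurl hn (isDiagram_shift.1 hy))⟩
  exact h.elim key fun h => Relation.EqvGen.symm _ _ (key h)

theorem Connected.of_K1 {S : Set Move} (h4 : Move.K4 1 ∈ S) {k l : ℕ} {A B : Diagram k l}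
    (h : Move.Applies Move.K1 A B) : Connected S A B := by
  have valid : ∀ b r i w n, IsDiagram w (shift i (cableCurl 1 b r)) n ↔
      IsDiagram w (shift i (encircled 1 b true)) n := by
    intro b r i w n
    cases r <;>
    · simp [cableCurl, cableCup, cableCap, cableCross, encircled, shift, Slice.cup,
        Slice.cap, Slice.cross, IsDiagram, Event.bot, Event.top]
      try omega
  have key : ∀ {A B : Diagram k l}, Replaces Move.K1.Pieces A B → Connected S A B := by
    rintro ⟨A, hA⟩ ⟨B, hB⟩ ⟨u, v, p, q, i, hp, rfl, rfl⟩
    cases hp with | K1 b =>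
    -- The encircled strand is the same for both values of `r`; the choice `c = true` is arbitrary.
    have e : ∀ r w', Eqv S w' (shift i (cableCurl 1 b r)) (shift i (encircled 1 b true)) :=
      fun r w' => Eqv.of_move h4 i (Move.Pieces.K4 1 b r true le_rfl) (valid b r i w')
    have := Eqv.mid (S := S) (w := k) u v fun w' _ => (e true w').trans (e false w').symm
    simp only [← List.append_assoc] at this
    exact (this l).2 hA hB
  exact h.elim key fun h => Relation.EqvGen.symm _ _ (key h)

theorem Connected.of_steps {S T : Set Move} {k l : ℕ} {A B : Diagram k l}
    (hST : ∀ M ∈ S, ∀ A B : Diagram k l, Move.Applies M A B → Connected T A B)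
    (h : Connected S A B) : Connected T A B := by
  induction h with
  | rel A B h =>
    rcases h with h | ⟨M, hM, h⟩
    · exact Relation.EqvGen.rel _ _ (Or.inl h)
    · exact hST M hM A B h
  | refl A => exact Relation.EqvGen.refl _
  | symm A B _ ih => exact Relation.EqvGen.symm _ _ ih
  | trans A B C _ _ ih ih' => exact Relation.EqvGen.trans _ _ _ ih ih'

theorem Connected.of_applies {S : Set Move} {M : Move} (hM : M ∈ S) {k l : ℕ} {A B : Diagram k l}
    (h : Move.Applies M A B) : Connected S A B :=
  Relation.EqvGen.rel _ _ (Or.inr ⟨M, hM, h⟩)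

theorem mainTheorem8 :
    (∀ (n : ℕ), 1 ≤ n → ∀ (k l : ℕ) (A B : Diagram k l), Move.Applies (Move.K5 n) A B →
      Connected {Move.K1, Move.K2, Move.K3} A B) ∧
    (∀ A B : BFL, Connected kauffmanCalculus A B ↔ Connected ribbonCalculus A B) := by
  refine ⟨fun n _ k l A B h => .of_K5 (by simp) (by simp) (by simp) h, fun A B => ⟨?_, ?_⟩⟩
  · refine Connected.of_steps fun M hM A B h => ?_
    rcases hM with (rfl | rfl | rfl) | ⟨n, hn, rfl | rfl⟩
    · exact .of_applies (by simp [ribbonCalculus]) h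
    · exact .of_applies (by simp [ribbonCalculus]) h
    · exact .of_applies (by simp [ribbonCalculus]) h
    · exact .of_applies (Or.inr ⟨n, hn, rfl⟩) h
    · exact .of_K5 (by simp [ribbonCalculus]) (by simp [ribbonCalculus])
        (by simp [ribbonCalculus]) h
  · refine Connected.of_steps fun M hM A B h => ?_
    rcases hM with (rfl | rfl | rfl | rfl) | ⟨n, hn, rfl⟩
    · exact .of_applies (by simp [kauffmanCalculus]) h
    · exact .of_K1 (Or.inr ⟨1, le_rfl, Or.inl rfl⟩) h
    · exact .of_applies (by simp [kauffmanCalculus]) h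
    · exact .of_applies (by simp [kauffmanCalculus]) h
    · exact .of_applies (Or.inr ⟨n, hn, Or.inl rfl⟩) h
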